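/- Let $n\ge 1$, $1\le \ell\le n+1$, and let $\varphi$ be a Tarski formula (Boolean combination of polynomial equations and inequalities) in the ordered variables $x_1,\dots,x_n$ with rational coefficients. Sub-algorithms. A projection operator $\mathtt{ProjOp}$ maps a finite set of polynomials in $k+1$ variables to one in $k$ variables. Applying it repeatedly to the set of polynomials of $\varphi$ gives, together with that set, the projection polynomials; $\mathbf P[i]$ is the set of those with main variable $x_i$. A procedure $\mathtt{GenerateStack}(\mathbf P[i],c)$, for a cell $c\subseteq\mathbb R^{i-1}$, returns FAIL or a list of cells of $\mathbb R^{i}$. A stack over $c$ is the list, from bottom to top, of the sections (graphs) of finitely many continuous functions $\xi_1<\dots<\xi_m$ on $c$ and of the sectors between, below and above them, all semi-algebraic and each stored with a sample point and with the index of $c$ extended by its position $1,\dots,2m+1$ (so sectors are odd, sections even). A CAD of $\mathbb R^{1}$ is a stack over the one-point space $\mathbb R^0$, and a CAD of $\mathbb R^{k+1}$ consists of all members of stacks over the cells of a CAD of $\mathbb R^k$. The pair of sub-algorithms is assumed to be compatible: for every such formula and every cell $c$ of $\mathbb R^{i-1}$, $2\le i\le n$, obtained by successful lifting (starting from $\mathcal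 D[1]$ below, without discarding cells), $\mathtt{GenerateStack}(\mathbf P[i],c)$ is either FAIL or a stack over $c$ on each cell of which every polynomial of $\mathbf P[i]$ has constant sign. The dimension of a cell of a CAD is the number of sectors among its successive projections to $\mathbb R^1,\dots,\mathbb R^n$. The algorithm $\mathtt{LayeredSubCAD}(\varphi,\ell)$ computes all $\mathbf P[i]$; lets $\mathcal D[1]$ be the CAD of $\mathbb R^1$ given by the real roots of $\mathbf P[1]$; for $i=2,\dots,n$ lets $\mathcal D[i]$ consist of the stacks $\mathtt{GenerateStack}(\mathbf P[i],c)$ over those $c\in\mathcal D[i-1]$ whose index has more than $i-\ell-1$ odd entries, discarding the other cells of $\mathcal D[i-1]$ and returning FAIL if one of these calls fails; and finally returns the cells of $\mathcal D[n]$ whose index has more than $n-\ell$ odd entries. Theorem. 1. $\mathtt{LayeredSubCAD}(\varphi,\ell)$ returns either FAIL or an $\ell$-layered sub-CAD, that is, the set of all cells of dimension $n-i$, $0\le i<\ell$ (equivalently, of dimension $\ge n-\ell+1$), of some CAD $\mathcal D$ of $\mathbb R^n$, whose cells of dimension $d$ are homeomorphic to $\mathbb R^d$. The polynomials of $\varphi$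 have constant sign, and $\varphi$ has constant truth value, on each returned cell, and on each cell of $\mathcal D$ except possibly those lying over a cell of some $\mathbb R^{i-1}$, $2\le i\le n$, of dimension $\le i-\ell-1$ (hence never lifted over by the algorithm), obtained by lifting without discarding, on which $\mathtt{GenerateStack}$ returns FAIL. 2. If the complete algorithm, $\mathtt{LayeredSubCAD}(\varphi,n+1)$, does not return FAIL, then its output is a CAD of $\mathbb R^n$ on each cell of which the polynomials of $\varphi$ have constant sign and $\varphi$ has constant truth value; in this case $\mathtt{LayeredSubCAD}(\varphi,\ell)$ does not return FAIL either, and returns exactly the set of all cells of dimension $\ge n-\ell+1$ of this CAD. -/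

import Mathlib

noncomputable section

namespace SubCAD

/-! ### Polynomials, formulae, invariance -/

/-- Quantifier-free Tarski formulae in the ordered variables `x₁, …, xₙ`, with rational
coefficients. The remaining relations `≤`, `≥`, `≠` are obtained with the connectives. -/
inductive TarskiFormula (n : ℕ) : Type where
  | eq (p : MvPolynomial (Fin n) ℚ) : TarskiFormula n
  | lt (p : MvPolynomial (Fin n) ℚ) : TarskiFormula n
  | gt (p : MvPolynomial (Fin n) ℚ) : TarskiFormula n
  | not (φ : TarskiFormula n) : TarskiFormula n
  | and (φ ψ : TarskiFormula n) : TarskiFormula n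
  | or (φ ψ : TarskiFormula n) : TarskiFormula n

/-- Truth of a formula at a point; the atoms are `p = 0`, `p < 0`, `p > 0`. -/
def TarskiFormula.Holds {n : ℕ} (x : Fin n → ℝ) : TarskiFormula n → Prop
  | .eq p => MvPolynomial.aeval x p = 0
  | .lt p => MvPolynomial.aeval x p < 0
  | .gt p => 0 < MvPolynomial.aeval x p
  | .not φ => ¬ φ.Holds x
  | .and φ ψ => φ.Holds x ∧ ψ.Holds x
  | .or φ ψ => φ.Holds x ∨ ψ.Holds x

open Classical in
/-- The polynomials occurring in a formula. -/
def TarskiFormula.polys {n : ℕ} : TarskiFormula n → Finset (MvPolynomial (Fin n) ℚ)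
  | .eq p => {p}
  | .lt p => {p}
  | .gt p => {p}
  | .not φ => φ.polys
  | .and φ ψ => φ.polys ∪ ψ.polys
  | .or φ ψ => φ.polys ∪ ψ.polys

/-- Every polynomial of `F` has constant sign on `c`. -/
def SignInvariant {k : ℕ} (F : Finset (MvPolynomial (Fin k) ℚ)) (c : Set (Fin k → ℝ)) : Prop :=
  ∀ p ∈ F, ∀ x ∈ c, ∀ y ∈ c,
    SignType.sign (MvPolynomial.aeval x p : ℝ) = SignType.sign (MvPolynomial.aeval y p : ℝ)

/-- The formula has constant truth value on `c`. -/
def TruthInvariant {k : ℕ} (φ : TarskiFormula k) (c : Set (Fin k → ℝ)) : Prop :=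
  ∀ x ∈ c, ∀ y ∈ c, (φ.Holds x ↔ φ.Holds y)

/-- Semi-algebraic subsets of `ℝᵏ`: Boolean combinations of polynomial sign conditions. -/
inductive Semialgebraic {k : ℕ} : Set (Fin k → ℝ) → Prop where
  | zero (p : MvPolynomial (Fin k) ℝ) : Semialgebraic {x | MvPolynomial.eval x p = 0}
  | pos (p : MvPolynomial (Fin k) ℝ) : Semialgebraic {x | 0 < MvPolynomial.eval x p}
  | compl {s : Set (Fin k → ℝ)} : Semialgebraic s → Semialgebraic sᶜ
  | inter {s t : Set (Fin k → ℝ)} : Semialgebraic s → Semialgebraic t → Semialgebraic (s ∩ t)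

/-! ### Cells, stacks, cylindrical algebraic decompositions -/

/-- The projection `ℝᵏ⁺¹ → ℝᵏ` forgetting the last coordinate. -/
def dropLast {k : ℕ} (x : Fin (k + 1) → ℝ) : Fin k → ℝ := fun i => x i.castSucc

/-- A cell as stored by the algorithms: a subset of `ℝᵏ` with its index and a sample point. -/
structure Cell (k : ℕ) where
  index : List ℕ
  sample : Fin k → ℝ
  carrier : Set (Fin k → ℝ)

/-- The dimension read off from the index: the number of odd entries. -/
def Cell.indexDim {k : ℕ} (c : Cell k) : ℕ := (c.index.map (fun a => a % 2)).sum

open Classical in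
/-- Geometric dimension of a cell of a cylindrical decomposition: passing from the projection of
the cell to the cell adds `0` for a section (a graph over the projection) and `1` for a sector. -/
def cellDim : (k : ℕ) → Set (Fin k → ℝ) → ℕ
  | 0, _ => 0
  | k + 1, c => cellDim k (dropLast '' c) + (if Set.InjOn dropLast c then 0 else 1)

/-- The section over `s` given by the graph of `f`. -/
def sectionOver {k : ℕ} (s : Set (Fin k → ℝ)) (f : (Fin k → ℝ) → ℝ) : Set (Fin (k + 1) → ℝ) :=
  {x | dropLast x ∈ s ∧ x (Fin.last k) = f (dropLast x)}

/-- The sector over `s` above the first `t` of the functions `ξ 0 < ξ 1 < ⋯ < ξ (m-1)` and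
below the remaining ones; it is unbounded below for `t = 0` and unbounded above for `t = m`. -/
def sectorOver {k m : ℕ} (s : Set (Fin k → ℝ)) (ξ : Fin m → (Fin k → ℝ) → ℝ) (t : ℕ) :
    Set (Fin (k + 1) → ℝ) :=
  {x | dropLast x ∈ s ∧ ∀ i : Fin m,
    ((i : ℕ) < t → ξ i (dropLast x) < x (Fin.last k)) ∧
    (t ≤ (i : ℕ) → x (Fin.last k) < ξ i (dropLast x))}

/-- The cells of the stack over `s` defined by `ξ 0 < ⋯ < ξ (m-1)`, from bottom to top (counted
from `0`): sector, section, sector, …, section, sector. -/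
def stackCell {k m : ℕ} (s : Set (Fin k → ℝ)) (ξ : Fin m → (Fin k → ℝ) → ℝ)
    (q : Fin (2 * m + 1)) : Set (Fin (k + 1) → ℝ) :=
  if h : (q : ℕ) % 2 = 1 then
    sectionOver s (ξ ⟨(q : ℕ) / 2, by have := q.isLt; omega⟩)
  else sectorOver s ξ ((q : ℕ) / 2)

/-- `S` is a stack over the cell `c`: its members are the sections of finitely many continuous
functions `ξ 0 < ⋯ < ξ (m-1)` on `c` and the sectors between them, listed from bottom to top, all
semi-algebraic, each with a sample point and with the index of `c` extended by its position
(counted from `1`, so that sectors get odd and sections get even numbers). -/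
def IsStack {k : ℕ} (c : Cell k) (S : List (Cell (k + 1))) : Prop :=
  ∃ (m : ℕ) (ξ : Fin m → (Fin k → ℝ) → ℝ) (cells : Fin (2 * m + 1) → Cell (k + 1)),
    (∀ i, ContinuousOn (ξ i) c.carrier) ∧
    (∀ x ∈ c.carrier, StrictMono fun i => ξ i x) ∧
    S = List.ofFn cells ∧
    ∀ q, (cells q).index = c.index ++ [(q : ℕ) + 1] ∧
      (cells q).carrier = stackCell c.carrier ξ q ∧
      (cells q).sample ∈ (cells q).carrier ∧
      Semialgebraic (cells q).carrier

/-- The unique cell of `ℝ⁰`. -/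
def originCell : Cell 0 := ⟨[], fun i => i.elim0, Set.univ⟩

/-- Cylindrical algebraic decompositions of `ℝᵏ`, as sets of cells: a CAD of `ℝᵏ⁺¹` consists of
the members of stacks over all the cells of a CAD of `ℝᵏ`. -/
def IsCAD : (k : ℕ) → Set (Cell k) → Prop
  | 0, D => D = {originCell}
  | k + 1, D => ∃ (D' : Set (Cell k)) (stack : Cell k → List (Cell (k + 1))),
      IsCAD k D' ∧ (∀ c ∈ D', IsStack c (stack c)) ∧ D = {x | ∃ c ∈ D', x ∈ stack c}

/-- `E` is the `ℓ`-layered sub-CAD of `D`: all the cells of `D` of dimension `n - i`,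
for `0 ≤ i < ℓ`. -/
def IsLayered {n : ℕ} (ℓ : ℕ) (D E : Set (Cell n)) : Prop :=
  E = {c | c ∈ D ∧ ∃ i < ℓ, cellDim n c.carrier + i = n}

/-! ### Projection and lifting -/

/-- A projection operator: it sends a finite set of polynomials in `k + 1` variables to one in
`k` variables. -/
abbrev ProjectionOperator : Type :=
  ∀ k : ℕ, Finset (MvPolynomial (Fin (k + 1)) ℚ) → Finset (MvPolynomial (Fin k) ℚ)

/-- A stack generation procedure: from polynomials in `k + 1` variables and a cell of `ℝᵏ` it
computes a list of cells of `ℝᵏ⁺¹`, or returns FAIL, encoded by `none`. -/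
abbrev StackGenerator : Type :=
  ∀ k : ℕ, Finset (MvPolynomial (Fin (k + 1)) ℚ) → Cell k → Option (List (Cell (k + 1)))

open Classical in
/-- The polynomials of `A` with main variable `x_{k+1}`, regarded as polynomials in
`x₁, …, x_{k+1}`. -/
def withMainVar {n : ℕ} (A : Finset (MvPolynomial (Fin n) ℚ)) (k : ℕ) :
    Finset (MvPolynomial (Fin (k + 1)) ℚ) :=
  if h : k + 1 ≤ n then
    (A.preimage (MvPolynomial.rename (Fin.castLE h))
      (MvPolynomial.rename_injective _ (Fin.castLE_injective h)).injOn).filter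
      (fun p => Fin.last k ∈ p.vars)
  else ∅

open Classical in
/-- Full projection phase: apply the projection operator to `A` repeatedly and collect, from `A`
and all the sets so obtained, the polynomials with main variable `x_{k+1}`. -/
def projectionPolys (proj : ProjectionOperator) :
    (n : ℕ) → Finset (MvPolynomial (Fin n) ℚ) → (k : ℕ) → Finset (MvPolynomial (Fin (k + 1)) ℚ)
  | 0, _, _ => ∅
  | n + 1, A, k => withMainVar A k ∪ projectionPolys proj n (proj n A) k

/-- The real roots of a finite set of univariate polynomials. -/
def realRoots (P : Finset (MvPolynomial (Fin 1) ℚ)) : Finset ℝ :=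
  P.biUnion fun p =>
    (MvPolynomial.aeval (fun _ : Fin 1 => (Polynomial.X : Polynomial ℝ)) p).roots.toFinset

/-- A sample point for each of the `2m + 1` cells of `ℝ¹` defined by `r 0 < ⋯ < r (m-1)`. -/
def lineSample {m : ℕ} (r : Fin m → ℝ) (q : Fin (2 * m + 1)) : ℝ :=
  if h : (q : ℕ) % 2 = 1 then r ⟨(q : ℕ) / 2, by have := q.isLt; omega⟩
  else if hm : m = 0 then 0
  else if h0 : (q : ℕ) = 0 then r ⟨0, by omega⟩ - 1
  else if h1 : (q : ℕ) = 2 * m then r ⟨m - 1, by omega⟩ + 1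
  else (r ⟨(q : ℕ) / 2 - 1, by have := q.isLt; omega⟩ +
    r ⟨(q : ℕ) / 2, by have := q.isLt; omega⟩) / 2

/-- The CAD of `ℝ¹` obtained by isolating the real roots of `P`. -/
def lineCAD (P : Finset (MvPolynomial (Fin 1) ℚ)) : List (Cell 1) :=
  let r : Fin (realRoots P).card → ℝ := (realRoots P).orderEmbOfFin rfl
  List.ofFn fun q =>
    { index := [(q : ℕ) + 1]
      sample := fun _ => lineSample r q
      carrier := stackCell Set.univ (fun i _ => r i) q }

/-- The lifting phase with `ℓ` layers, up to a list of cells of `ℝⁱ`. In the step to level `i`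
only cells of level `i - 1` of dimension `> i - ℓ - 1` are lifted over, the others are discarded;
if stack generation fails over one of the lifted cells, the result is FAIL. -/
def lift (gen : StackGenerator) (P : ∀ k, Finset (MvPolynomial (Fin (k + 1)) ℚ)) (ℓ : ℕ) :
    (i : ℕ) → Option (List (Cell i))
  | 0 => some [originCell]
  | 1 => some (lineCAD (P 0))
  | i + 2 => do
      let D ← lift gen P ℓ (i + 1)
      let stks ←
        (D.filter fun c => decide (((i + 2 : ℕ) : ℤ) - ℓ - 1 < (c.indexDim : ℤ))).mapM
          (gen (i + 1) (P (i + 1)))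
      return stks.flatten

/-- The algorithm `LayeredSubCAD`: projection, lifting with discarding, and removal of the cells
of low dimension from the final lift. `none` stands for FAIL. -/
def layeredSubCAD {n : ℕ} (proj : ProjectionOperator) (gen : StackGenerator)
    (φ : TarskiFormula n) (ℓ : ℕ) : Option (List (Cell n)) := do
  let D ← lift gen (projectionPolys proj n φ.polys) ℓ n
  return D.filter fun c => decide ((n : ℤ) - ℓ < (c.indexDim : ℤ))

/-- The cells reached by lifting without any discarding: the cells of the decomposition of the
line, and the members of every stack successfully generated over a reached cell. -/
inductive Reached (gen : StackGenerator) (P : ∀ k, Finset (MvPolynomial (Fin (k + 1)) ℚ)) :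
    (k : ℕ) → Cell k → Prop where
  | line {c : Cell 1} : c ∈ lineCAD (P 0) → Reached gen P 1 c
  | step {k : ℕ} {c : Cell k} {S : List (Cell (k + 1))} {x : Cell (k + 1)} :
      Reached gen P k c → gen k (P k) c = some S → x ∈ S → Reached gen P (k + 1) x

/-- A compatible choice of projection operator and stack generation procedure in `n` variables:
given the projection polynomials of a formula and a cell that lifting has produced,
stack generation either fails or returns a stack over that cell on whose members the given
polynomials have constant sign. Nothing is required when the procedure fails, nor of its behaviour
on any other input. -/
def Compatible (n : ℕ) (proj : ProjectionOperator) (gen : StackGenerator) : Prop :=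
  ∀ (φ : TarskiFormula n) (k : ℕ), k < n →
    ∀ (c : Cell k) (S : List (Cell (k + 1))),
      Reached gen (projectionPolys proj n φ.polys) k c →
      gen k (projectionPolys proj n φ.polys k) c = some S →
      IsStack c S ∧ ∀ x ∈ S, SignInvariant (projectionPolys proj n φ.polys k) x.carrier

/-- `c` lies over a cell of some lower level `k` that the `ℓ`-layered lifting discards (its
dimension is at most `k - ℓ`, that is, `≤ i - ℓ - 1` in the step to level `i = k + 1`) and over
which stack generation would fail. -/
def OverDiscardedFailure {n : ℕ} (gen : StackGenerator)
    (P : ∀ k, Finset (MvPolynomial (Fin (k + 1)) ℚ)) (ℓ : ℕ) (c : Cell n) : Prop :=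
  ∃ (k : ℕ) (hk : k < n) (b : Cell k), Reached gen P k b ∧ b.indexDim + ℓ ≤ k ∧
    gen k (P k) b = none ∧ ∀ x ∈ c.carrier, (fun i => x (Fin.castLE hk.le i)) ∈ b.carrier

end SubCAD

end

noncomputable section

namespace SubCAD

/-! ### Topology of sections and sectors -/

/-! The CAD `D` is `completedCAD`: lift over every cell, discarding none, and use a single full
cylinder over each cell that is not reached or on which `gen` fails. This is a CAD whether or not
generation fails somewhere, and it does not depend on `ℓ`, so one decomposition serves for both
halves of the theorem.

A member of a stack has dimension at most one more than its base. Hence a cell of `D` of dimension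
`> n - ℓ` projects at every level `k` to a cell of dimension `> k - ℓ`, and these are exactly the
cells that the layered run lifts over. If the run does not fail, `gen` succeeded on all of them, so
every high-dimensional cell of `D` is found (`mem_lift_of_mem_completedCAD`); conversely all cells
found lie in `D` (`mem_completedCAD_of_mem_lift`). For `ℓ = n + 1` the dimension condition is void
and the output is all of `D`. Fewer layers mean fewer calls of `gen`, so success of the complete run
implies success of the layered one (`exists_lift_of_le`).

Counting odd index entries gives the geometric dimension because a section is homeomorphic to its
base and a sector to its base times `ℝ` (`IsStack.regular_mem`).

For signs, induction along successful lifting shows that all projection polynomials seen so far are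
invariant on a reached cell (`Reached.signInvariantBelow`). Every polynomial of `φ` is constant or
is a projection polynomial at the level of its main variable. A cell of `D` that is not reached lies
over some reached cell where `gen` failed, and that cell must have been discarded, since otherwise
the run would have failed (`reached_or_overDiscardedFailure`). -/

/-- The fibre, over `x`, of the sector above the first `t` of the functions `ξ i`. -/
def gap {k m : ℕ} (ξ : Fin m → (Fin k → ℝ) → ℝ) (t : ℕ) (x : Fin k → ℝ) : Set ℝ :=
  {y | ∀ i : Fin m, ((i : ℕ) < t → ξ i x < y) ∧ (t ≤ (i : ℕ) → y < ξ i x)}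

/-- The fibres `I x`, for `x ∈ s`, are homeomorphic to `ℝ`, continuously in `x`. -/
def IsBand {α : Type*} [TopologicalSpace α] (s : Set α) (I : α → Set ℝ) : Prop :=
  ∃ u v : α → ℝ → ℝ,
    ContinuousOn (fun p : α × ℝ => u p.1 p.2) {p | p.1 ∈ s ∧ p.2 ∈ I p.1} ∧
    ContinuousOn (fun p : α × ℝ => v p.1 p.2) {p | p.1 ∈ s} ∧
    (∀ x ∈ s, ∀ y ∈ I x, v x (u x y) = y) ∧
    ∀ x ∈ s, ∀ y, v x y ∈ I x ∧ u x (v x y) = y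

section Band

variable {α : Type*} [TopologicalSpace α] {s : Set α} {I : α → Set ℝ}

lemma IsBand.of_univ (h : ∀ x ∈ s, I x = Set.univ) : IsBand s I := by
  refine ⟨fun _ y => y, fun _ y => y, continuous_snd.continuousOn, continuous_snd.continuousOn,
    fun _ _ _ _ => rfl, fun x hx y => ⟨?_, rfl⟩⟩
  rw [h x hx]; trivial

lemma continuousOn_comp_fst {f : α → ℝ} (hf : ContinuousOn f s) {T : Set (α × ℝ)}
    (hT : ∀ p ∈ T, p.1 ∈ s) : ContinuousOn (fun p : α × ℝ => f p.1) T :=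
  hf.comp continuous_fst.continuousOn hT

lemma IsBand.of_Ioi {a : α → ℝ} (ha : ContinuousOn a s) (h : ∀ x ∈ s, I x = Set.Ioi (a x)) :
    IsBand s I := by
  refine ⟨fun x y => Real.log (y - a x), fun x y => a x + Real.exp y, ?_, ?_, ?_, ?_⟩
  · refine ContinuousOn.log
      (continuous_snd.continuousOn.sub (continuousOn_comp_fst ha fun p hp => hp.1)) ?_
    rintro p ⟨hp, hy⟩
    rw [h _ hp] at hy
    exact (sub_pos.2 hy).ne'
  · exact (continuousOn_comp_fst ha fun p hp => hp).add
      (Real.continuous_exp.comp continuous_snd).continuousOn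
  · intro x hx y hy
    rw [h _ hx] at hy
    simp only [Real.exp_log (sub_pos.2 hy)]
    ring
  · intro x hx y
    rw [h _ hx]
    simp [Real.exp_pos]

lemma IsBand.of_Iio {b : α → ℝ} (hb : ContinuousOn b s) (h : ∀ x ∈ s, I x = Set.Iio (b x)) :
    IsBand s I := by
  refine ⟨fun x y => Real.log (b x - y), fun x y => b x - Real.exp y, ?_, ?_, ?_, ?_⟩
  · refine ContinuousOn.log
      ((continuousOn_comp_fst hb fun p hp => hp.1).sub continuous_snd.continuousOn) ?_
    rintro p ⟨hp, hy⟩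
    rw [h _ hp] at hy
    exact (sub_pos.2 hy).ne'
  · exact (continuousOn_comp_fst hb fun p hp => hp).sub
      (Real.continuous_exp.comp continuous_snd).continuousOn
  · intro x hx y hy
    rw [h _ hx] at hy
    simp only [Real.exp_log (sub_pos.2 hy)]
    ring
  · intro x hx y
    rw [h _ hx]
    simp [Real.exp_pos]

/-- The fibre is straightened by the logit `log ((y - a) / (b - y))`, whose inverse is the mean of
`a` and `b` with weights `1` and `exp y`. -/
lemma IsBand.of_Ioo {a b : α → ℝ} (ha : ContinuousOn a s) (hb : ContinuousOn b s)
    (hab : ∀ x ∈ s, a x < b x) (h : ∀ x ∈ s, I x = Set.Ioo (a x) (b x)) : IsBand s I := by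
  refine ⟨fun x y => Real.log (y - a x) - Real.log (b x - y),
    fun x y => (a x + b x * Real.exp y) / (1 + Real.exp y), ?_, ?_, ?_, ?_⟩
  · have ha' : ContinuousOn (fun p : α × ℝ => a p.1) {p | p.1 ∈ s ∧ p.2 ∈ I p.1} :=
      continuousOn_comp_fst ha fun p hp => hp.1
    have hb' : ContinuousOn (fun p : α × ℝ => b p.1) {p | p.1 ∈ s ∧ p.2 ∈ I p.1} :=
      continuousOn_comp_fst hb fun p hp => hp.1
    refine ((continuous_snd.continuousOn.sub ha').log ?_).sub
      ((hb'.sub continuous_snd.continuousOn).log ?_)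
    all_goals
      rintro p ⟨hp, hy⟩
      rw [h _ hp] at hy
    · exact (sub_pos.2 hy.1).ne'
    · exact (sub_pos.2 hy.2).ne'
  · have he : ContinuousOn (fun p : α × ℝ => Real.exp p.2) {p | p.1 ∈ s} :=
      (Real.continuous_exp.comp continuous_snd).continuousOn
    refine ((continuousOn_comp_fst ha fun p hp => hp).add
      ((continuousOn_comp_fst hb fun p hp => hp).mul he)).div
      (continuousOn_const.add he) fun p _ => ?_
    positivity
  · intro x hx y hy
    rw [h _ hx] at hy
    have h1 := sub_pos.2 hy.1
    have h2 := sub_pos.2 hy.2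
    have h3 := sub_pos.2 (hab x hx)
    simp only [Real.exp_sub, Real.exp_log h1, Real.exp_log h2]
    have h4 : 1 + (y - a x) / (b x - y) = (b x - a x) / (b x - y) := by
      field_simp; ring
    rw [h4]
    field_simp
    ring
  · intro x hx y
    rw [h _ hx]
    have he := Real.exp_pos y
    have h3 := sub_pos.2 (hab x hx)
    have e1 : (a x + b x * Real.exp y) / (1 + Real.exp y) - a x
        = Real.exp y * ((b x - a x) / (1 + Real.exp y)) := by
      field_simp; ring
    have e2 : b x - (a x + b x * Real.exp y) / (1 + Real.exp y)
        = (b x - a x) / (1 + Real.exp y) := by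
      field_simp; ring
    have hq : 0 < (b x - a x) / (1 + Real.exp y) := by positivity
    refine ⟨⟨sub_pos.1 (e1 ▸ by positivity), sub_pos.1 (e2 ▸ hq)⟩, ?_⟩
    simp only [e1, e2]
    rw [Real.log_mul he.ne' hq.ne', Real.log_exp]
    ring

end Band

/-- Because the functions increase, only the neighbours `ξ (t - 1)` and `ξ t` matter; the fibre is a
line, a ray or a bounded interval according to which of them exist. -/
lemma isBand_gap {k m : ℕ} {s : Set (Fin k → ℝ)} {ξ : Fin m → (Fin k → ℝ) → ℝ}
    (hc : ∀ i, ContinuousOn (ξ i) s) (hm : ∀ x ∈ s, StrictMono fun i => ξ i x) {t : ℕ}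
    (ht : t ≤ m) : IsBand s (gap ξ t) := by
  rcases Nat.eq_zero_or_pos t with rfl | h0
  · rcases Nat.eq_zero_or_pos m with rfl | hm0
    · exact IsBand.of_univ fun x _ => Set.eq_univ_of_forall fun y i => i.elim0
    · refine IsBand.of_Iio (hc ⟨0, hm0⟩) fun x hx => Set.ext fun y => ⟨fun h => ?_, fun h i => ?_⟩
      · exact (h ⟨0, hm0⟩).2 le_rfl
      · exact ⟨fun h' => absurd h' (by omega), fun _ =>
          lt_of_lt_of_le h ((hm x hx).monotone (Nat.zero_le i))⟩
  · have hlo : ∀ x ∈ s, ∀ y, ξ ⟨t - 1, by omega⟩ x < y ↔ ∀ i : Fin m, (i : ℕ) < t → ξ i x < y :=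
      fun x hx y => ⟨fun h i hi => lt_of_le_of_lt
        ((hm x hx).monotone (show (i : ℕ) ≤ t - 1 by omega)) h,
        fun h => h _ (show t - 1 < t by omega)⟩
    rcases ht.eq_or_lt with rfl | htm
    · refine IsBand.of_Ioi (hc ⟨t - 1, by omega⟩) fun x hx => Set.ext fun y => ?_
      rw [Set.mem_Ioi, hlo x hx]
      exact ⟨fun h i => (h i).1, fun h i => ⟨h i, fun h' => absurd i.isLt (by omega)⟩⟩
    · refine IsBand.of_Ioo (hc ⟨t - 1, by omega⟩) (hc ⟨t, htm⟩)
        (fun x hx => hm x hx (show t - 1 < t by omega)) fun x hx => Set.ext fun y => ?_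
      rw [Set.mem_Ioo, hlo x hx]
      exact ⟨fun h => ⟨fun i => (h i).1, (h ⟨t, htm⟩).2 le_rfl⟩, fun h i => ⟨h.1 i, fun h' =>
        lt_of_lt_of_le h.2 ((hm x hx).monotone (show t ≤ (i : ℕ) from h'))⟩⟩

/-! ### Splitting off the last coordinate: homeomorphism type and dimension of sections and sectors
-/

lemma continuous_dropLast {k : ℕ} : Continuous (dropLast (k := k)) :=
  continuous_pi fun i => continuous_apply i.castSucc

lemma dropLast_snoc {k : ℕ} (x : Fin k → ℝ) (y : ℝ) :
    dropLast (Fin.snoc x y : Fin (k + 1) → ℝ) = x := by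
  funext i; simp [dropLast]

lemma snoc_dropLast {k : ℕ} (x : Fin (k + 1) → ℝ) :
    (Fin.snoc (dropLast x) (x (Fin.last k)) : Fin (k + 1) → ℝ) = x := by
  funext i
  refine Fin.lastCases ?_ (fun j => ?_) i <;> simp [dropLast]

lemma continuous_snoc {k : ℕ} :
    Continuous fun p : (Fin k → ℝ) × ℝ => (Fin.snoc p.1 p.2 : Fin (k + 1) → ℝ) :=
  Continuous.finSnoc (A := fun _ => ℝ) continuous_fst continuous_snd

/-- `ℝᵏ × ℝ ≃ₜ ℝᵏ⁺¹`, appending a last coordinate. -/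
def snocHomeomorph (k : ℕ) : (Fin k → ℝ) × ℝ ≃ₜ (Fin (k + 1) → ℝ) where
  toFun p := Fin.snoc p.1 p.2
  invFun x := (dropLast x, x (Fin.last k))
  left_inv p := by simp [dropLast_snoc]
  right_inv x := snoc_dropLast x
  continuous_toFun := continuous_snoc
  continuous_invFun := continuous_dropLast.prodMk (continuous_apply _)

lemma nonempty_homeomorph_sectionOver {k : ℕ} {s : Set (Fin k → ℝ)} {f : (Fin k → ℝ) → ℝ}
    (hf : ContinuousOn f s) : Nonempty (sectionOver s f ≃ₜ s) :=
  ⟨{ toFun := fun x => ⟨dropLast x.1, x.2.1⟩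
     invFun := fun y => ⟨Fin.snoc y.1 (f y.1), by simp [sectionOver, dropLast_snoc]⟩
     left_inv := fun x => Subtype.ext (by
       change Fin.snoc (dropLast x.1) (f (dropLast x.1)) = x.1
       rw [← x.2.2, snoc_dropLast])
     right_inv := fun y => Subtype.ext (dropLast_snoc _ _)
     continuous_toFun := (continuous_dropLast.comp continuous_subtype_val).subtype_mk _
     continuous_invFun := continuous_induced_rng.2 (continuous_snoc.comp
       (continuous_subtype_val.prodMk hf.domRestrict)) }⟩

lemma nonempty_homeomorph_band {k : ℕ} {s : Set (Fin k → ℝ)} {I : (Fin k → ℝ) → Set ℝ}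
    (h : IsBand s I) :
    Nonempty ({x : Fin (k + 1) → ℝ | dropLast x ∈ s ∧ x (Fin.last k) ∈ I (dropLast x)}
      ≃ₜ s × ℝ) := by
  obtain ⟨u, v, hu, hv, hvu, huv⟩ := h
  exact ⟨
   { toFun := fun x => (⟨dropLast x.1, x.2.1⟩, u (dropLast x.1) (x.1 (Fin.last k)))
     invFun := fun p => ⟨Fin.snoc p.1.1 (v p.1.1 p.2), by
       simpa [dropLast_snoc] using (huv p.1.1 p.1.2 p.2).1⟩
     left_inv := fun x => Subtype.ext (by
       change Fin.snoc (dropLast x.1) (v (dropLast x.1) (u (dropLast x.1) (x.1 (Fin.last k)))) = x.1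
       rw [hvu _ x.2.1 _ x.2.2, snoc_dropLast])
     right_inv := fun p => Prod.ext (Subtype.ext (dropLast_snoc _ _)) (by
       simpa [dropLast_snoc] using (huv p.1.1 p.1.2 p.2).2)
     continuous_toFun :=
       ((continuous_dropLast.comp continuous_subtype_val).subtype_mk _).prodMk
        (hu.comp_continuous (f := fun x : {x : Fin (k + 1) → ℝ |
            dropLast x ∈ s ∧ x (Fin.last k) ∈ I (dropLast x)} =>
              (dropLast x.1, x.1 (Fin.last k)))
          ((continuous_dropLast.comp continuous_subtype_val).prodMk
            ((continuous_apply _).comp continuous_subtype_val)) fun x => x.2)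
     continuous_invFun := continuous_induced_rng.2 (continuous_snoc.comp
       ((continuous_subtype_val.comp continuous_fst).prodMk
         (hv.comp_continuous (f := fun p : s × ℝ => (p.1.1, p.2))
          ((continuous_subtype_val.comp continuous_fst).prodMk continuous_snd)
          fun p => p.1.2))) }⟩

lemma image_dropLast_sectionOver {k : ℕ} (s : Set (Fin k → ℝ)) (f : (Fin k → ℝ) → ℝ) :
    dropLast '' sectionOver s f = s := by
  ext x
  constructor
  · rintro ⟨y, hy, rfl⟩
    exact hy.1
  · intro hx
    exact ⟨Fin.snoc x (f x), by simpa [sectionOver, dropLast_snoc] using hx, dropLast_snoc _ _⟩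

lemma injOn_dropLast_sectionOver {k : ℕ} (s : Set (Fin k → ℝ)) (f : (Fin k → ℝ) → ℝ) :
    Set.InjOn dropLast (sectionOver s f) := by
  intro x hx y hy h
  rw [← snoc_dropLast x, ← snoc_dropLast y, hx.2, hy.2, h]

lemma cellDim_sectionOver {k : ℕ} (s : Set (Fin k → ℝ)) (f : (Fin k → ℝ) → ℝ) :
    cellDim (k + 1) (sectionOver s f) = cellDim k s := by
  rw [cellDim, image_dropLast_sectionOver, if_pos (injOn_dropLast_sectionOver s f), add_zero]

/-- Over one base point the fibre contains the two points `v x 0` and `v x 1`, which `u x`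
separates, so the projection is not injective. A nonempty base is essential: on the empty set every
map is injective. -/
lemma cellDim_band {k : ℕ} {s : Set (Fin k → ℝ)} {I : (Fin k → ℝ) → Set ℝ} (h : IsBand s I)
    (hs : s.Nonempty) :
    cellDim (k + 1) {x | dropLast x ∈ s ∧ x (Fin.last k) ∈ I (dropLast x)} = cellDim k s + 1 := by
  obtain ⟨u, v, -, -, -, huv⟩ := h
  have hmem : ∀ x ∈ s, ∀ y, (Fin.snoc x (v x y) : Fin (k + 1) → ℝ) ∈
      {x : Fin (k + 1) → ℝ | dropLast x ∈ s ∧ x (Fin.last k) ∈ I (dropLast x)} := fun x hx y => by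
    simpa [dropLast_snoc] using ⟨hx, (huv x hx y).1⟩
  have himage : dropLast ''
      {x : Fin (k + 1) → ℝ | dropLast x ∈ s ∧ x (Fin.last k) ∈ I (dropLast x)} = s := by
    ext x
    constructor
    · rintro ⟨y, hy, rfl⟩
      exact hy.1
    · exact fun hx => ⟨_, hmem x hx 0, dropLast_snoc _ _⟩
  rw [cellDim, himage, if_neg]
  intro hinj
  obtain ⟨x, hx⟩ := hs
  have h01 := hinj (hmem x hx 0) (hmem x hx 1) (by simp [dropLast_snoc])
  have h01' := congrArg (u x) (congrFun h01 (Fin.last k))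
  simp only [Fin.snoc_last, (huv x hx _).2] at h01'
  exact zero_ne_one h01'

/-! ### The cells of a decomposition -/

/-- The properties of a cell that are inherited by the members of a stack over it. -/
structure Cell.Regular {k : ℕ} (c : Cell k) : Prop where
  sample_mem : c.sample ∈ c.carrier
  semialgebraic : Semialgebraic c.carrier
  cellDim_eq : cellDim k c.carrier = c.indexDim
  indexDim_le : c.indexDim ≤ k
  homeomorph : Nonempty (c.carrier ≃ₜ (Fin (cellDim k c.carrier) → ℝ))

lemma semialgebraic_univ {k : ℕ} : Semialgebraic (Set.univ : Set (Fin k → ℝ)) := by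
  simpa using Semialgebraic.zero (0 : MvPolynomial (Fin k) ℝ)

lemma regular_originCell : originCell.Regular where
  sample_mem := trivial
  semialgebraic := semialgebraic_univ
  cellDim_eq := rfl
  indexDim_le := le_rfl
  homeomorph := ⟨Homeomorph.Set.univ _⟩

/-- Positions `q` start at `0` but the stored entry is `q + 1`, which reverses parity: odd `q` is a
section and adds nothing. -/
lemma indexDim_of_index_eq {k : ℕ} {c : Cell k} {x : Cell (k + 1)} {q : ℕ}
    (h : x.index = c.index ++ [q + 1]) :
    x.indexDim = c.indexDim + if q % 2 = 1 then 0 else 1 := by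
  simp only [Cell.indexDim, h, List.map_append, List.sum_append, List.map_cons, List.map_nil,
    List.sum_cons, List.sum_nil]
  split_ifs <;> omega

/-- This inequality is what makes discarding harmless: low-dimensional cells have no
high-dimensional descendants. -/
lemma IsStack.indexDim_mem {k : ℕ} {c : Cell k} {S : List (Cell (k + 1))} (hS : IsStack c S)
    {x : Cell (k + 1)} (hx : x ∈ S) : x.indexDim ≤ c.indexDim + 1 := by
  obtain ⟨m, ξ, cells, -, -, rfl, h⟩ := hS
  obtain ⟨q, rfl⟩ := (List.mem_ofFn' cells x).1 hx
  rw [indexDim_of_index_eq (h q).1]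
  split_ifs <;> omega

lemma stackCell_of_odd {k m : ℕ} (s : Set (Fin k → ℝ)) (ξ : Fin m → (Fin k → ℝ) → ℝ)
    {q : Fin (2 * m + 1)} (h : (q : ℕ) % 2 = 1) :
    stackCell s ξ q = sectionOver s (ξ ⟨(q : ℕ) / 2, by have := q.isLt; omega⟩) :=
  dif_pos h

lemma stackCell_of_even {k m : ℕ} (s : Set (Fin k → ℝ)) (ξ : Fin m → (Fin k → ℝ) → ℝ)
    {q : Fin (2 * m + 1)} (h : ¬ (q : ℕ) % 2 = 1) :
    stackCell s ξ q =
      {x | dropLast x ∈ s ∧ x (Fin.last k) ∈ gap ξ ((q : ℕ) / 2) (dropLast x)} :=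
  dif_neg h

lemma stackCell_subset {k m : ℕ} (s : Set (Fin k → ℝ)) (ξ : Fin m → (Fin k → ℝ) → ℝ)
    (q : Fin (2 * m + 1)) {x : Fin (k + 1) → ℝ} (hx : x ∈ stackCell s ξ q) : dropLast x ∈ s := by
  unfold stackCell at hx
  split_ifs at hx
  exacts [hx.1, hx.1]

lemma IsStack.dropLast_mem {k : ℕ} {c : Cell k} {S : List (Cell (k + 1))} (hS : IsStack c S)
    {x : Cell (k + 1)} (hx : x ∈ S) {y : Fin (k + 1) → ℝ} (hy : y ∈ x.carrier) :
    dropLast y ∈ c.carrier := by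
  obtain ⟨m, ξ, cells, -, -, rfl, h⟩ := hS
  obtain ⟨q, rfl⟩ := (List.mem_ofFn' cells x).1 hx
  rw [(h q).2.1] at hy
  exact stackCell_subset _ _ _ hy

lemma IsStack.regular_mem {k : ℕ} {c : Cell k} {S : List (Cell (k + 1))} (hS : IsStack c S)
    (hc : c.Regular) {x : Cell (k + 1)} (hx : x ∈ S) : x.Regular := by
  have hle := hS.indexDim_mem hx
  obtain ⟨m, ξ, cells, hcont, hmono, rfl, h⟩ := hS
  obtain ⟨q, rfl⟩ := (List.mem_ofFn' cells x).1 hx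
  obtain ⟨hidx, hcar, hsam, hsemi⟩ := h q
  obtain ⟨e⟩ := hc.homeomorph
  have hdim := indexDim_of_index_eq hidx
  have hq := q.isLt
  refine ⟨hsam, hsemi, ?_, hle.trans (by have := hc.indexDim_le; omega), ?_⟩
  · rw [hcar, hdim, ← hc.cellDim_eq]
    split_ifs with hodd
    · rw [stackCell_of_odd _ _ hodd, cellDim_sectionOver, add_zero]
    · rw [stackCell_of_even _ _ hodd]
      exact cellDim_band (isBand_gap hcont hmono (by omega)) ⟨_, hc.sample_mem⟩
  · rw [hcar]
    by_cases hodd : (q : ℕ) % 2 = 1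
    · obtain ⟨e'⟩ := nonempty_homeomorph_sectionOver (hcont ⟨(q : ℕ) / 2, by omega⟩)
      rw [stackCell_of_odd _ _ hodd, cellDim_sectionOver]
      exact ⟨e'.trans e⟩
    · have hb := isBand_gap hcont hmono (t := (q : ℕ) / 2) (by omega)
      obtain ⟨e'⟩ := nonempty_homeomorph_band hb
      rw [stackCell_of_even _ _ hodd, cellDim_band hb ⟨_, hc.sample_mem⟩]
      exact ⟨e'.trans ((e.prodCongr (Homeomorph.refl ℝ)).trans (snocHomeomorph _))⟩

lemma IsCAD.regular_mem : ∀ {k : ℕ} {D : Set (Cell k)}, IsCAD k D → ∀ c ∈ D, c.Regular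
  | 0, _, hD, c, hc => by
    obtain rfl : c = originCell := by rw [show _ = _ from hD] at hc; exact hc
    exact regular_originCell
  | _ + 1, _, ⟨_, _, hD', hstack, hD⟩, c, hc => by
    rw [hD] at hc
    obtain ⟨b, hb, hcb⟩ := hc
    exact (hstack b hb).regular_mem (hD'.regular_mem b hb) hcb

/-- The stack over `c` that consists of the full cylinder. -/
def cylinderStack {k : ℕ} (c : Cell k) : List (Cell (k + 1)) :=
  [⟨c.index ++ [1], Fin.snoc c.sample 0, dropLast ⁻¹' c.carrier⟩]

lemma Semialgebraic.preimage_dropLast {k : ℕ} {s : Set (Fin k → ℝ)} (hs : Semialgebraic s) :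
    Semialgebraic (dropLast ⁻¹' s) := by
  have hev : ∀ (p : MvPolynomial (Fin k) ℝ) (x : Fin (k + 1) → ℝ),
      MvPolynomial.eval (dropLast x) p = MvPolynomial.eval x (MvPolynomial.rename Fin.castSucc p) :=
    fun p x => (MvPolynomial.eval_rename _ _ _).symm
  induction hs with
  | zero p =>
    have := Semialgebraic.zero (MvPolynomial.rename Fin.castSucc p)
    simp only [← hev] at this
    exact this
  | pos p =>
    have := Semialgebraic.pos (MvPolynomial.rename Fin.castSucc p)
    simp only [← hev] at this
    exact this
  | compl _ ih => exact ih.compl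
  | inter _ _ ih₁ ih₂ => exact ih₁.inter ih₂

lemma isStack_cylinderStack {k : ℕ} {c : Cell k} (hc : c.Regular) :
    IsStack c (cylinderStack c) := by
  refine ⟨0, fun i => i.elim0, fun _ => ⟨c.index ++ [1], Fin.snoc c.sample 0,
    dropLast ⁻¹' c.carrier⟩, fun i => i.elim0, fun _ _ i => i.elim0, rfl, fun q => ?_⟩
  obtain ⟨q, hq⟩ := q
  obtain rfl : q = 0 := by omega
  refine ⟨rfl, ?_, ?_, hc.semialgebraic.preimage_dropLast⟩
  · ext x
    simp [stackCell, sectorOver]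
  · simpa [dropLast_snoc] using hc.sample_mem

/-! ### The decomposition of the line -/

lemma Semialgebraic.iInter_of_finite {k : ℕ} {ι : Type*} [Finite ι] {s : ι → Set (Fin k → ℝ)}
    (h : ∀ i, Semialgebraic (s i)) : Semialgebraic (⋂ i, s i) := by
  classical
  have := Fintype.ofFinite ι
  have key : ∀ F : Finset ι, Semialgebraic (⋂ i ∈ F, s i) := fun F => by
    induction F using Finset.induction_on with
    | empty => simpa using semialgebraic_univ
    | insert a F _ ih => rw [Finset.set_biInter_insert]; exact (h a).inter ih
  simpa using key Finset.univ

lemma semialgebraic_setOf_eq_const {k : ℕ} (j : Fin k) (a : ℝ) :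
    Semialgebraic {x : Fin k → ℝ | x j = a} := by
  have h := Semialgebraic.zero (MvPolynomial.X j - MvPolynomial.C a : MvPolynomial (Fin k) ℝ)
  simp only [map_sub, MvPolynomial.eval_X, MvPolynomial.eval_C, sub_eq_zero] at h
  exact h

lemma semialgebraic_setOf_const_lt {k : ℕ} (j : Fin k) (a : ℝ) :
    Semialgebraic {x : Fin k → ℝ | a < x j} := by
  have h := Semialgebraic.pos (MvPolynomial.X j - MvPolynomial.C a : MvPolynomial (Fin k) ℝ)
  simp only [map_sub, MvPolynomial.eval_X, MvPolynomial.eval_C, sub_pos] at h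
  exact h

lemma semialgebraic_setOf_lt_const {k : ℕ} (j : Fin k) (a : ℝ) :
    Semialgebraic {x : Fin k → ℝ | x j < a} := by
  have h := Semialgebraic.pos (MvPolynomial.C a - MvPolynomial.X j : MvPolynomial (Fin k) ℝ)
  simp only [map_sub, MvPolynomial.eval_X, MvPolynomial.eval_C, sub_pos] at h
  exact h

lemma semialgebraic_stackCell_const {m : ℕ} (r : Fin m → ℝ) (q : Fin (2 * m + 1)) :
    Semialgebraic (stackCell (k := 0) Set.univ (fun i _ => r i) q) := by
  by_cases hodd : (q : ℕ) % 2 = 1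
  · rw [stackCell_of_odd _ _ hodd]
    simpa [sectionOver] using semialgebraic_setOf_eq_const (k := 1) (Fin.last 0) _
  · rw [stackCell_of_even _ _ hodd]
    have h : ∀ i : Fin m, Semialgebraic {x : Fin 1 → ℝ |
        ((i : ℕ) < (q : ℕ) / 2 → r i < x (Fin.last 0)) ∧
        ((q : ℕ) / 2 ≤ (i : ℕ) → x (Fin.last 0) < r i)} := fun i => by
      by_cases hi : (i : ℕ) < (q : ℕ) / 2
      · simpa [hi, not_le.2 hi] using semialgebraic_setOf_const_lt (k := 1) (Fin.last 0) (r i)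
      · simpa [hi, not_lt.1 hi] using semialgebraic_setOf_lt_const (k := 1) (Fin.last 0) (r i)
    convert Semialgebraic.iInter_of_finite h using 1
    ext x
    simp [gap]

lemma lineSample_mem {m : ℕ} {r : Fin m → ℝ} (hr : StrictMono r) (q : Fin (2 * m + 1)) :
    (fun _ => lineSample r q) ∈ stackCell (k := 0) Set.univ (fun i _ => r i) q := by
  have hq := q.isLt
  by_cases hodd : (q : ℕ) % 2 = 1
  · rw [stackCell_of_odd _ _ hodd]
    exact ⟨trivial, by simp [lineSample, hodd]⟩
  · rw [stackCell_of_even _ _ hodd]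
    refine ⟨trivial, fun i => ?_⟩
    have hi := i.isLt
    have hle : ∀ {j : Fin m}, (i : ℕ) ≤ j → r i ≤ r j := fun h => hr.monotone h
    have hge : ∀ {j : Fin m}, (j : ℕ) ≤ i → r j ≤ r i := fun h => hr.monotone h
    simp only [lineSample, hodd, dif_neg (show ¬ m = 0 by omega), dite_false]
    split_ifs with h0 h1
    · refine ⟨fun h => absurd h (by omega), fun _ => ?_⟩
      have := hge (j := ⟨0, by omega⟩) (Nat.zero_le _)
      linarith
    · refine ⟨fun _ => ?_, fun h => absurd h (by omega)⟩
      have := hle (j := ⟨m - 1, by omega⟩) (show (i : ℕ) ≤ m - 1 by omega)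
      linarith
    · have hlt : r ⟨(q : ℕ) / 2 - 1, by omega⟩ < r ⟨(q : ℕ) / 2, by omega⟩ :=
        hr (show (q : ℕ) / 2 - 1 < (q : ℕ) / 2 by omega)
      refine ⟨fun h => ?_, fun h => ?_⟩
      · have := hle (j := ⟨(q : ℕ) / 2 - 1, by omega⟩) (show (i : ℕ) ≤ (q : ℕ) / 2 - 1 by omega)
        linarith
      · have := hge (j := ⟨(q : ℕ) / 2, by omega⟩) h
        linarith

lemma isStack_lineCAD (P : Finset (MvPolynomial (Fin 1) ℚ)) : IsStack originCell (lineCAD P) :=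
  ⟨(realRoots P).card, fun i _ => (realRoots P).orderEmbOfFin rfl i, _,
    fun _ => continuousOn_const, fun _ _ => ((realRoots P).orderEmbOfFin rfl).strictMono, rfl,
    fun q => ⟨rfl, rfl, lineSample_mem ((realRoots P).orderEmbOfFin rfl).strictMono q,
      semialgebraic_stackCell_const _ q⟩⟩

/-! ### Signs of univariate polynomials between their real roots -/

/-- The real univariate polynomial attached to a polynomial in one variable. -/
def toUnivariate (p : MvPolynomial (Fin 1) ℚ) : Polynomial ℝ :=
  MvPolynomial.aeval (fun _ : Fin 1 => (Polynomial.X : Polynomial ℝ)) p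

lemma eval_toUnivariate (p : MvPolynomial (Fin 1) ℚ) (x : Fin 1 → ℝ) :
    (toUnivariate p).eval (x 0) = MvPolynomial.aeval x p := by
  have h : ((Polynomial.aeval (x 0)).restrictScalars ℚ).comp
      (MvPolynomial.aeval (fun _ : Fin 1 => (Polynomial.X : Polynomial ℝ))) =
      (MvPolynomial.aeval x : MvPolynomial (Fin 1) ℚ →ₐ[ℚ] ℝ) := by
    ext i
    simp [Subsingleton.elim i 0]
  have := DFunLike.congr_fun h p
  simpa [toUnivariate, Polynomial.coe_aeval_eq_eval] using this

/-- Needed because `Polynomial.roots` of zero is empty. A vanishing image would make `p` zero at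
every rational point, hence zero since `ℚ` is infinite. -/
lemma toUnivariate_ne_zero {p : MvPolynomial (Fin 1) ℚ} (hp : p ≠ 0) : toUnivariate p ≠ 0 := by
  intro h
  refine hp (MvPolynomial.funext fun a => ?_)
  have h1 := eval_toUnivariate p (algebraMap ℚ ℝ ∘ a)
  rw [h, Polynomial.eval_zero, MvPolynomial.aeval_algebraMap_apply] at h1
  have h2 := (algebraMap ℚ ℝ).injective (h1.symm.trans (map_zero _).symm)
  simpa [MvPolynomial.aeval_eq_eval] using h2

lemma mem_realRoots {P : Finset (MvPolynomial (Fin 1) ℚ)} {p : MvPolynomial (Fin 1) ℚ}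
    (hp : p ∈ P) (hp0 : p ≠ 0) {a : ℝ} (ha : (toUnivariate p).eval a = 0) : a ∈ realRoots P := by
  simp only [realRoots, Finset.mem_biUnion, Multiset.mem_toFinset]
  exact ⟨p, hp, (Polynomial.mem_roots (toUnivariate_ne_zero hp0)).2 ha⟩

/-- The image of an interval is order connected, so values of opposite sign would force it to
contain `0`. -/
lemma sign_eq_of_forall_ne_zero {f : ℝ → ℝ} (hf : Continuous f) {s : Set ℝ} (hs : s.OrdConnected)
    (h0 : ∀ z ∈ s, f z ≠ 0) {a b : ℝ} (ha : a ∈ s) (hb : b ∈ s) :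
    SignType.sign (f a) = SignType.sign (f b) := by
  have him := (hs.isPreconnected.image f hf.continuousOn).ordConnected
  have hfa : f a ∈ f '' s := ⟨a, ha, rfl⟩
  have hfb : f b ∈ f '' s := ⟨b, hb, rfl⟩
  have h00 : (0 : ℝ) ∉ f '' s := fun ⟨z, hz, h⟩ => h0 z hz h
  rcases lt_or_gt_of_ne (h0 a ha) with h | h <;> rcases lt_or_gt_of_ne (h0 b hb) with h' | h'
  · rw [sign_neg h, sign_neg h']
  · exact absurd (him.out hfa hfb ⟨h.le, h'.le⟩) h00
  · exact absurd (him.out hfb hfa ⟨h'.le, h.le⟩) h00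
  · rw [sign_pos h, sign_pos h']

lemma ordConnected_gap {k m : ℕ} (ξ : Fin m → (Fin k → ℝ) → ℝ) (t : ℕ) (x : Fin k → ℝ) :
    (gap ξ t x).OrdConnected :=
  ⟨fun _ ha _ hb _ hz i => ⟨fun h => ((ha i).1 h).trans_le hz.1,
    fun h => hz.2.trans_lt ((hb i).2 h)⟩⟩

lemma signInvariant_lineCAD {P : Finset (MvPolynomial (Fin 1) ℚ)} (hP : ∀ p ∈ P, p ≠ 0)
    {c : Cell 1} (hc : c ∈ lineCAD P) : SignInvariant P c.carrier := by
  obtain ⟨q, rfl⟩ := (List.mem_ofFn' _ c).1 hc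
  intro p hp x hx y hy
  set r := (realRoots P).orderEmbOfFin rfl
  change x ∈ stackCell (k := 0) Set.univ (fun i _ => r i) q at hx
  change y ∈ stackCell (k := 0) Set.univ (fun i _ => r i) q at hy
  rw [← eval_toUnivariate, ← eval_toUnivariate]
  by_cases hodd : (q : ℕ) % 2 = 1
  · rw [stackCell_of_odd _ _ hodd] at hx hy
    rw [show x 0 = y 0 from hx.2.trans hy.2.symm]
  · rw [stackCell_of_even _ _ hodd] at hx hy
    -- The bounding functions are constant, so the fibres over `dropLast x` and `dropLast y` are
    -- both the fibre over `default`.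
    refine sign_eq_of_forall_ne_zero (toUnivariate p).continuous
      (ordConnected_gap (k := 0) (fun i _ => r i) ((q : ℕ) / 2) default) (fun z hz h0 => ?_)
      hx.2 hy.2
    have hzr := mem_realRoots hp (hP p hp) h0
    rw [← Finset.mem_coe, ← Finset.range_orderEmbOfFin (realRoots P) rfl] at hzr
    obtain ⟨i, rfl⟩ := hzr
    by_cases hi : (i : ℕ) < (q : ℕ) / 2
    · exact lt_irrefl _ ((hz i).1 hi)
    · exact lt_irrefl _ ((hz i).2 (not_lt.1 hi))

/-! ### Projection polynomials and formulae -/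

lemma last_mem_vars_of_mem_withMainVar {n : ℕ} {A : Finset (MvPolynomial (Fin n) ℚ)} {k : ℕ}
    {p : MvPolynomial (Fin (k + 1)) ℚ} (hp : p ∈ withMainVar A k) : Fin.last k ∈ p.vars := by
  unfold withMainVar at hp
  split_ifs at hp
  · exact (Finset.mem_filter.1 hp).2
  · simp at hp

/-- A polynomial with a main variable is not zero; at level one this guarantees that `realRoots`
misses no root. -/
lemma ne_zero_of_mem_projectionPolys (proj : ProjectionOperator) {k : ℕ}
    {p : MvPolynomial (Fin (k + 1)) ℚ} :
    ∀ {n : ℕ} {A : Finset (MvPolynomial (Fin n) ℚ)}, p ∈ projectionPolys proj n A k → p ≠ 0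
  | 0, _, hp => by simp [projectionPolys] at hp
  | n + 1, _, hp => by
    rw [projectionPolys, Finset.mem_union] at hp
    rcases hp with hp | hp
    · rintro rfl
      simpa using last_mem_vars_of_mem_withMainVar hp
    · exact ne_zero_of_mem_projectionPolys proj hp

/-- On `s`, the polynomials of every `P j` with `j < k` have constant sign. -/
def SignInvariantBelow {k : ℕ} (P : ∀ k, Finset (MvPolynomial (Fin (k + 1)) ℚ))
    (s : Set (Fin k → ℝ)) : Prop :=
  ∀ (j : ℕ) (hj : j + 1 ≤ k), ∀ p ∈ P j, ∀ x ∈ s, ∀ y ∈ s,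
    SignType.sign (MvPolynomial.aeval (fun i => x (Fin.castLE hj i)) p : ℝ) =
      SignType.sign (MvPolynomial.aeval (fun i => y (Fin.castLE hj i)) p : ℝ)

/-- Take `j` to be the largest variable of `p`: then `p` involves only the first `j + 1` variables
and comes from a polynomial `q` in these. -/
lemma exists_mem_withMainVar {n : ℕ} {A : Finset (MvPolynomial (Fin n) ℚ)}
    {p : MvPolynomial (Fin n) ℚ} (hp : p ∈ A) (hv : p.vars.Nonempty) :
    ∃ (j : ℕ) (hj : j + 1 ≤ n), ∃ q ∈ withMainVar A j, MvPolynomial.rename (Fin.castLE hj) q = p := by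
  have hj := (p.vars.max' hv).isLt
  have hinj := Fin.castLE_injective hj
  obtain ⟨q, hq⟩ := MvPolynomial.exists_rename_eq_of_vars_subset_range p (Fin.castLE hj) hinj
    fun i hi => by
      have hle : i ≤ p.vars.max' hv := Finset.le_max' _ _ hi
      exact ⟨⟨i, Nat.lt_succ_of_le hle⟩, rfl⟩
  refine ⟨_, hj, q, ?_, hq⟩
  rw [withMainVar, dif_pos (show (p.vars.max' hv : ℕ) + 1 ≤ n from hj), Finset.mem_filter,
    Finset.mem_preimage]
  refine ⟨hq.symm ▸ hp, ?_⟩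
  have hmax := p.vars.max'_mem hv
  -- The type of `q` mentions the maximum, hence `p`; it is made opaque so that `p` can be rewritten
  -- in `hmax` alone.
  generalize p.vars.max' hv = M at *
  rw [← hq] at hmax
  obtain ⟨i, hi, hiM⟩ := MvPolynomial.mem_vars_rename _ _ hmax
  have : i = Fin.last (M : ℕ) := Fin.ext (by simpa using congrArg Fin.val hiM)
  exact this ▸ hi

lemma SignInvariantBelow.signInvariant {n : ℕ} {proj : ProjectionOperator}
    {A : Finset (MvPolynomial (Fin n) ℚ)} {s : Set (Fin n → ℝ)}
    (h : SignInvariantBelow (projectionPolys proj n A) s) : SignInvariant A s := by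
  intro p hp x hx y hy
  rcases p.vars.eq_empty_or_nonempty with hv | hv
  · obtain ⟨a, rfl⟩ : ∃ a, p = MvPolynomial.C a := ⟨_, MvPolynomial.vars_eq_empty_iff_eq_C.1 hv⟩
    simp
  · obtain ⟨j, hj, q, hq, rfl⟩ := exists_mem_withMainVar hp hv
    obtain ⟨m, rfl⟩ : ∃ m, n = m + 1 := ⟨n - 1, by omega⟩
    rw [MvPolynomial.aeval_rename, MvPolynomial.aeval_rename]
    exact h j hj q (by rw [projectionPolys]; exact Finset.mem_union_left _ hq) x hx y hy

lemma SignInvariant.truthInvariant {n : ℕ} {s : Set (Fin n → ℝ)} :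
    ∀ {φ : TarskiFormula n}, SignInvariant φ.polys s → TruthInvariant φ s
  | .eq p, h, x, hx, y, hy => by
    have := h p (by simp [TarskiFormula.polys]) x hx y hy
    simp only [TarskiFormula.Holds]
    rw [← sign_eq_zero_iff, this, sign_eq_zero_iff]
  | .lt p, h, x, hx, y, hy => by
    have := h p (by simp [TarskiFormula.polys]) x hx y hy
    simp only [TarskiFormula.Holds]
    rw [← sign_eq_neg_one_iff, this, sign_eq_neg_one_iff]
  | .gt p, h, x, hx, y, hy => by
    have := h p (by simp [TarskiFormula.polys]) x hx y hy
    simp only [TarskiFormula.Holds]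
    rw [← sign_eq_one_iff, this, sign_eq_one_iff]
  | .not φ, h, x, hx, y, hy => not_congr (SignInvariant.truthInvariant (φ := φ) h x hx y hy)
  | .and φ ψ, h, x, hx, y, hy =>
    and_congr
      (SignInvariant.truthInvariant (φ := φ)
        (fun p hp => h p (by simp [TarskiFormula.polys, hp])) x hx y hy)
      (SignInvariant.truthInvariant (φ := ψ)
        (fun p hp => h p (by simp [TarskiFormula.polys, hp])) x hx y hy)
  | .or φ ψ, h, x, hx, y, hy =>
    or_congr
      (SignInvariant.truthInvariant (φ := φ)
        (fun p hp => h p (by simp [TarskiFormula.polys, hp])) x hx y hy)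
      (SignInvariant.truthInvariant (φ := ψ)
        (fun p hp => h p (by simp [TarskiFormula.polys, hp])) x hx y hy)

/-! ### Lifting -/

lemma exists_mapM_eq_some_iff {α β : Type*} {f : α → Option β} {l : List α} :
    (∃ s, l.mapM f = some s) ↔ ∀ a ∈ l, f a ≠ none := by
  induction l with
  | nil => simp
  | cons a l ih =>
    rw [List.forall_mem_cons, ← ih]
    cases h : f a <;> simp [List.mapM_cons, h, Option.bind_eq_some_iff]

lemma mem_flatten_of_mapM_eq_some {α β : Type*} {f : α → Option (List β)} {l : List α}
    {s : List (List β)} (h : l.mapM f = some s) {x : β} :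
    x ∈ s.flatten ↔ ∃ a ∈ l, ∃ S, f a = some S ∧ x ∈ S := by
  induction l generalizing s with
  | nil =>
    obtain rfl : [] = s := by simpa using h
    simp
  | cons a l ih =>
    rw [List.mapM_cons] at h
    obtain ⟨b, hb, t, ht, rfl⟩ : ∃ b, f a = some b ∧ ∃ t, l.mapM f = some t ∧ b :: t = s := by
      simpa [Option.bind_eq_some_iff] using h
    simp [ih ht, hb]

section Lifting

variable {gen : StackGenerator} {P : ∀ k, Finset (MvPolynomial (Fin (k + 1)) ℚ)} {ℓ : ℕ}

/-- The integer condition `i + 2 - ℓ - 1 < dim` is put as `i + 1 < dim + ℓ`, free of subtraction,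
for use with natural numbers. -/
lemma lift_eq_some_iff {i : ℕ} {L : List (Cell (i + 2))} :
    lift gen P ℓ (i + 2) = some L ↔ ∃ D, lift gen P ℓ (i + 1) = some D ∧
      ∃ s, (D.filter fun c => decide (i + 1 < c.indexDim + ℓ)).mapM (gen (i + 1) (P (i + 1))) =
        some s ∧ s.flatten = L := by
  have hfilter : ∀ D : List (Cell (i + 1)),
      (D.filter fun c => decide (((i + 2 : ℕ) : ℤ) - ℓ - 1 < (c.indexDim : ℤ))) =
        D.filter fun c => decide (i + 1 < c.indexDim + ℓ) := fun D =>
    List.filter_congr fun c _ => decide_eq_decide.2 (by omega)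
  rw [lift]
  simp only [hfilter]
  refine Option.bind_eq_some_iff.trans (exists_congr fun D => and_congr Iff.rfl ?_)
  refine Option.bind_eq_some_iff.trans (exists_congr fun s => and_congr Iff.rfl ?_)
  exact Option.some_inj

lemma exists_lift_eq_some_iff {i : ℕ} :
    (∃ L, lift gen P ℓ (i + 2) = some L) ↔ ∃ D, lift gen P ℓ (i + 1) = some D ∧
      ∀ c ∈ D, i + 1 < c.indexDim + ℓ → gen (i + 1) (P (i + 1)) c ≠ none := by
  simp only [lift_eq_some_iff]
  rw [exists_comm]
  refine exists_congr fun D => ?_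
  simp only [exists_and_left]
  refine and_congr Iff.rfl ?_
  rw [exists_comm]
  simp only [exists_and_left, exists_eq', and_true]
  rw [exists_mapM_eq_some_iff]
  simp only [List.mem_filter, decide_eq_true_eq, and_imp]

lemma mem_lift_iff {i : ℕ} {D : List (Cell (i + 1))} {L : List (Cell (i + 2))}
    (hD : lift gen P ℓ (i + 1) = some D) (hL : lift gen P ℓ (i + 2) = some L) {x : Cell (i + 2)} :
    x ∈ L ↔ ∃ c ∈ D, i + 1 < c.indexDim + ℓ ∧
      ∃ S, gen (i + 1) (P (i + 1)) c = some S ∧ x ∈ S := by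
  obtain ⟨D', hD', s, hs, rfl⟩ := lift_eq_some_iff.1 hL
  obtain rfl := Option.some_inj.1 (hD.symm.trans hD')
  rw [mem_flatten_of_mapM_eq_some hs]
  simp only [List.mem_filter, decide_eq_true_eq, and_assoc]

lemma reached_of_mem_lift : ∀ {i : ℕ} {L : List (Cell (i + 1))}, lift gen P ℓ (i + 1) = some L →
    ∀ {c : Cell (i + 1)}, c ∈ L → Reached gen P (i + 1) c
  | 0, _, hL, _, hc => .line (Option.some_inj.1 hL ▸ hc)
  | i + 1, _, hL, _, hc => by
    obtain ⟨D, hD, -⟩ := lift_eq_some_iff.1 hL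
    obtain ⟨b, hb, -, S, hS, hcS⟩ := (mem_lift_iff hD hL).1 hc
    exact .step (reached_of_mem_lift hD hb) hS hcS

/-! ### The completed decomposition and its comparison with layered lifting -/

open Classical in
/-- The stack generated over `c` if `c` is reached and generation succeeds, and the trivial stack
otherwise. -/
def completedStack (gen : StackGenerator) (P : ∀ k, Finset (MvPolynomial (Fin (k + 1)) ℚ)) {k : ℕ}
    (c : Cell k) : List (Cell (k + 1)) :=
  if Reached gen P k c then (gen k (P k) c).getD (cylinderStack c) else cylinderStack c

/-- Lifting without discarding, with trivial stacks wherever stack generation is not available. -/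
def completedCAD (gen : StackGenerator) (P : ∀ k, Finset (MvPolynomial (Fin (k + 1)) ℚ)) :
    (k : ℕ) → Set (Cell k)
  | 0 => {originCell}
  | 1 => {c | c ∈ lineCAD (P 0)}
  | k + 2 => {x | ∃ c ∈ completedCAD gen P (k + 1), x ∈ completedStack gen P c}

lemma completedStack_eq {k : ℕ} {c : Cell k} {S : List (Cell (k + 1))} (hc : Reached gen P k c)
    (hS : gen k (P k) c = some S) : completedStack gen P c = S := by
  simp [completedStack, hc, hS]

lemma completedStack_eq_cylinderStack {k : ℕ} {c : Cell k}
    (h : ∀ S, Reached gen P k c → gen k (P k) c ≠ some S) :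
    completedStack gen P c = cylinderStack c := by
  by_cases hc : Reached gen P k c
  · have : gen k (P k) c = none := Option.eq_none_iff_forall_ne_some.2 fun S => h S hc
    simp [completedStack, this]
  · simp [completedStack, hc]

/-- Whenever stack generation succeeds over a reached cell of level `k < n`, it returns a stack
over it on whose members the polynomials of `P k` have constant sign. -/
def GeneratesInvariantStacks (n : ℕ) (gen : StackGenerator)
    (P : ∀ k, Finset (MvPolynomial (Fin (k + 1)) ℚ)) : Prop :=
  ∀ k < n, ∀ (c : Cell k) (S : List (Cell (k + 1))), Reached gen P k c → gen k (P k) c = some S →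
    IsStack c S ∧ ∀ x ∈ S, SignInvariant (P k) x.carrier

variable {n : ℕ}

lemma isStack_completedStack (hgen : GeneratesInvariantStacks n gen P) {k : ℕ} (hk : k < n)
    {c : Cell k} (hc : c.Regular) : IsStack c (completedStack gen P c) := by
  by_cases h : ∃ S, Reached gen P k c ∧ gen k (P k) c = some S
  · obtain ⟨S, hr, hS⟩ := h
    rw [completedStack_eq hr hS]
    exact (hgen k hk c S hr hS).1
  · push Not at h
    rw [completedStack_eq_cylinderStack h]
    exact isStack_cylinderStack hc

/-- Level one is separate because it comes from root isolation, not from `gen`. Above it, the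
induction also supplies the regularity of each cell that the cylinder stack requires. -/
lemma isCAD_completedCAD (hgen : GeneratesInvariantStacks n gen P) :
    ∀ {k : ℕ}, k ≤ n → IsCAD k (completedCAD gen P k)
  | 0, _ => rfl
  | 1, _ => ⟨{originCell}, fun _ => lineCAD (P 0), rfl,
      fun c hc => by rw [Set.mem_singleton_iff.1 hc]; exact isStack_lineCAD _,
      by ext; simp [completedCAD]⟩
  | k + 2, hk =>
    have ih := isCAD_completedCAD hgen (k := k + 1) (by omega)
    ⟨completedCAD gen P (k + 1), completedStack gen P, ih,
      fun c hc => isStack_completedStack hgen (by omega) (ih.regular_mem c hc), rfl⟩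

lemma mem_completedCAD_of_mem_lift : ∀ {i : ℕ} {L : List (Cell (i + 1))},
    lift gen P ℓ (i + 1) = some L → ∀ {c : Cell (i + 1)}, c ∈ L → c ∈ completedCAD gen P (i + 1)
  | 0, _, hL, c, hc => by
    rw [← Option.some_inj.1 hL] at hc
    exact hc
  | i + 1, _, hL, _, hc => by
    obtain ⟨D, hD, -⟩ := lift_eq_some_iff.1 hL
    obtain ⟨b, hb, -, S, hS, hcS⟩ := (mem_lift_iff hD hL).1 hc
    exact ⟨b, mem_completedCAD_of_mem_lift hD hb,
      (completedStack_eq (reached_of_mem_lift hD hb) hS).symm ▸ hcS⟩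

/-- Going down one level costs at most one dimension and lowers the threshold by one, so the base
satisfies the same kind of bound. -/
lemma mem_lift_of_mem_completedCAD (hgen : GeneratesInvariantStacks n gen P) :
    ∀ {i : ℕ} {L : List (Cell (i + 1))}, i + 1 ≤ n → lift gen P ℓ (i + 1) = some L →
      ∀ {c : Cell (i + 1)}, c ∈ completedCAD gen P (i + 1) → i + 1 < c.indexDim + ℓ → c ∈ L
  | 0, _, _, hL, _, hc, _ => Option.some_inj.1 hL ▸ hc
  | i + 1, _, hi, hL, c, ⟨b, hb, hcb⟩, hdim => by
    obtain ⟨D, hD, hsucc⟩ := exists_lift_eq_some_iff.1 ⟨_, hL⟩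
    have hstack := isStack_completedStack hgen (k := i + 1) (by omega)
      ((isCAD_completedCAD hgen (by omega)).regular_mem b hb)
    have hle := hstack.indexDim_mem hcb
    -- The bound `i + 1 < b.indexDim + ℓ` serves twice: as induction hypothesis, and as the
    -- condition for lifting over `b`.
    have hbD := mem_lift_of_mem_completedCAD hgen (by omega) hD hb (by omega)
    obtain ⟨S, hS⟩ := Option.ne_none_iff_exists'.1 (hsucc b hbD (by omega))
    refine (mem_lift_iff hD hL).2 ⟨b, hbD, by omega, S, hS, ?_⟩
    rwa [completedStack_eq (reached_of_mem_lift hD hbD) hS] at hcb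

/-- Polynomials of lower levels do not see the last coordinate and inherit invariance from the base;
those of the top level are invariant by compatibility, or by root isolation on the line. -/
lemma Reached.signInvariantBelow (hgen : GeneratesInvariantStacks n gen P)
    (hP : ∀ p ∈ P 0, p ≠ 0) {k : ℕ} {c : Cell k} (hc : Reached gen P k c) (hk : k ≤ n) :
    SignInvariantBelow P c.carrier := by
  induction hc with
  | line hc =>
    intro j hj p hp x hx y hy
    obtain rfl : j = 0 := by omega
    exact signInvariant_lineCAD hP hc p hp x hx y hy
  | @step k c S x hc hS hx ih =>
    obtain ⟨hstack, hinv⟩ := hgen k (by omega) c S hc hS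
    intro j hj p hp y hy z hz
    obtain hjk | rfl : j + 1 ≤ k ∨ j = k := by omega
    · exact ih (by omega) j hjk p hp (dropLast y) (hstack.dropLast_mem hx hy) (dropLast z)
        (hstack.dropLast_mem hx hz)
    · exact hinv x hx p hp y hy z hz

lemma reached_or_overDiscardedFailure (hgen : GeneratesInvariantStacks n gen P) :
    ∀ {i : ℕ} {L : List (Cell (i + 1))}, i + 1 ≤ n → lift gen P ℓ (i + 1) = some L →
      ∀ {c : Cell (i + 1)}, c ∈ completedCAD gen P (i + 1) →
        Reached gen P (i + 1) c ∨ OverDiscardedFailure gen P ℓ c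
  | 0, _, _, _, _, hc => .inl (.line hc)
  | i + 1, _, hi, hL, c, ⟨b, hb, hcb⟩ => by
    obtain ⟨D, hD, hsucc⟩ := exists_lift_eq_some_iff.1 ⟨_, hL⟩
    have hstack := isStack_completedStack hgen (k := i + 1) (by omega)
      ((isCAD_completedCAD hgen (by omega)).regular_mem b hb)
    rcases reached_or_overDiscardedFailure hgen (by omega) hD hb with hr |
      ⟨k, hk, a, ha, hadim, hfail, hsub⟩
    · cases hS : gen (i + 1) (P (i + 1)) b with
      | some S =>
        rw [completedStack_eq hr hS] at hcb
        exact .inl (.step hr hS hcb)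
      | none =>
        refine .inr ⟨i + 1, by omega, b, hr, ?_, hS, fun x hx => hstack.dropLast_mem hcb hx⟩
        -- Were `b` of high dimension, the run would have contained it and called `gen` on it
        -- successfully, against `hS`.
        by_contra! hlt
        exact hsucc b (mem_lift_of_mem_completedCAD hgen (by omega) hD hb hlt) hlt hS
    · exact .inr ⟨k, by omega, a, ha, hadim, hfail,
        fun x hx => hsub _ (hstack.dropLast_mem hcb hx)⟩

/-- Fewer layers lift over a subset of the cells, so every call of `gen` already succeeded in the
larger run. -/
lemma exists_lift_of_le {ℓ' : ℕ} (hℓ : ℓ ≤ ℓ') : ∀ {i : ℕ} {L' : List (Cell (i + 1))},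
    lift gen P ℓ' (i + 1) = some L' → ∃ L, lift gen P ℓ (i + 1) = some L ∧ L ⊆ L'
  | 0, _, hL' => ⟨_, hL', List.Subset.refl _⟩
  | i + 1, _, hL' => by
    obtain ⟨D', hD', hsucc⟩ := exists_lift_eq_some_iff.1 ⟨_, hL'⟩
    obtain ⟨D, hD, hsub⟩ := exists_lift_of_le hℓ hD'
    obtain ⟨L, hL⟩ := exists_lift_eq_some_iff.2
      ⟨D, hD, fun c hc hdim => hsucc c (hsub hc) (by omega)⟩
    refine ⟨L, hL, fun x hx => ?_⟩
    obtain ⟨c, hc, hdim, hS⟩ := (mem_lift_iff hD hL).1 hx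
    exact (mem_lift_iff hD' hL').2 ⟨c, hsub hc, by omega, hS⟩

end Lifting

/-! ### The output of the algorithm -/

lemma layeredSubCAD_eq_some_iff {n : ℕ} {proj : ProjectionOperator} {gen : StackGenerator}
    {φ : TarskiFormula n} {ℓ : ℕ} {E : List (Cell n)} :
    layeredSubCAD proj gen φ ℓ = some E ↔
      ∃ L, lift gen (projectionPolys proj n φ.polys) ℓ n = some L ∧
        L.filter (fun c => decide (n < c.indexDim + ℓ)) = E := by
  refine Option.bind_eq_some_iff.trans (exists_congr fun L => and_congr Iff.rfl ?_)
  rw [show (L.filter fun c => decide (n < c.indexDim + ℓ)) =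
      L.filter fun c => decide ((n : ℤ) - ℓ < (c.indexDim : ℤ)) from
    List.filter_congr fun c _ => decide_eq_decide.2 (by omega)]
  exact Option.some_inj

lemma isLayered_iff_indexDim {n ℓ : ℕ} {D E : Set (Cell n)} (hD : ∀ c ∈ D, c.Regular) :
    IsLayered ℓ D E ↔ E = {c | c ∈ D ∧ n < c.indexDim + ℓ} := by
  have : {c | c ∈ D ∧ ∃ i < ℓ, cellDim n c.carrier + i = n} =
      {c | c ∈ D ∧ n < c.indexDim + ℓ} := by
    ext c
    refine and_congr_right fun hc => ?_
    have hle := (hD c hc).indexDim_le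
    rw [(hD c hc).cellDim_eq]
    exact ⟨fun ⟨i, hi, h⟩ => by omega, fun h => ⟨n - c.indexDim, by omega, by omega⟩⟩
  rw [IsLayered, this]

/-- The output of the algorithm, when it does not fail, consists of the cells of high dimension of
the completed decomposition. -/
lemma mem_layeredSubCAD_iff {n : ℕ} (hn : 1 ≤ n) {proj : ProjectionOperator} {gen : StackGenerator}
    {φ : TarskiFormula n} {ℓ : ℕ}
    (hgen : GeneratesInvariantStacks n gen (projectionPolys proj n φ.polys)) {E : List (Cell n)}
    (hE : layeredSubCAD proj gen φ ℓ = some E) {c : Cell n} :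
    c ∈ E ↔ c ∈ completedCAD gen (projectionPolys proj n φ.polys) n ∧ n < c.indexDim + ℓ := by
  obtain ⟨L, hL, rfl⟩ := layeredSubCAD_eq_some_iff.1 hE
  obtain ⟨i, rfl⟩ : ∃ i, n = i + 1 := ⟨n - 1, by omega⟩
  simp only [List.mem_filter, decide_eq_true_eq]
  exact ⟨fun h => ⟨mem_completedCAD_of_mem_lift hL h.1, h.2⟩,
    fun h => ⟨mem_lift_of_mem_completedCAD hgen le_rfl hL h.1 h.2, h.2⟩⟩

lemma invariant_of_mem_layeredSubCAD {n : ℕ} (hn : 1 ≤ n) {proj : ProjectionOperator}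
    {gen : StackGenerator} {φ : TarskiFormula n} {ℓ : ℕ}
    (hgen : GeneratesInvariantStacks n gen (projectionPolys proj n φ.polys)) {E : List (Cell n)}
    (hE : layeredSubCAD proj gen φ ℓ = some E) {c : Cell n} (hc : c ∈ E) :
    SignInvariant φ.polys c.carrier ∧ TruthInvariant φ c.carrier := by
  obtain ⟨L, hL, rfl⟩ := layeredSubCAD_eq_some_iff.1 hE
  obtain ⟨i, rfl⟩ : ∃ i, n = i + 1 := ⟨n - 1, by omega⟩
  have hs := ((reached_of_mem_lift hL (List.mem_filter.1 hc).1).signInvariantBelow hgen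
    (fun p => ne_zero_of_mem_projectionPolys proj) le_rfl).signInvariant
  exact ⟨hs, hs.truthInvariant⟩

end SubCAD

end

/-- For compatible sub-algorithms, `LayeredSubCAD` returns either FAIL or the `ℓ`-layered sub-CAD
of a CAD `D`. The dimension of the cells is their topological dimension. The polynomials
of `φ` have constant sign on the returned cells, and on all cells of `D` except those over a
discarded cell on which stack generation would fail. If the complete algorithm (`n + 1` layers)
does not fail, its output is a CAD sign-invariant for `φ`, and the `ℓ`-layered output is exactly
the `ℓ`-layered sub-CAD of this CAD. -/
theorem theorem2 (n ℓ : ℕ) (hn : 1 ≤ n) (hℓ : 1 ≤ ℓ) (hℓn : ℓ ≤ n + 1)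
    (proj : SubCAD.ProjectionOperator) (gen : SubCAD.StackGenerator)
    (hcompat : SubCAD.Compatible n proj gen) (φ : SubCAD.TarskiFormula n) :
    (SubCAD.layeredSubCAD proj gen φ ℓ = none ∨
      ∃ (E : List (SubCAD.Cell n)) (D : Set (SubCAD.Cell n)),
        SubCAD.layeredSubCAD proj gen φ ℓ = some E ∧
        SubCAD.IsCAD n D ∧
        SubCAD.IsLayered ℓ D {c | c ∈ E} ∧
        (∀ c ∈ D, Nonempty (c.carrier ≃ₜ (Fin (SubCAD.cellDim n c.carrier) → ℝ))) ∧
        (∀ c ∈ E, SubCAD.SignInvariant φ.polys c.carrier ∧ SubCAD.TruthInvariant φ c.carrier) ∧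
        ∀ c ∈ D, (SubCAD.SignInvariant φ.polys c.carrier ∧ SubCAD.TruthInvariant φ c.carrier) ∨
          SubCAD.OverDiscardedFailure gen (SubCAD.projectionPolys proj n φ.polys) ℓ c) ∧
    (∀ C : List (SubCAD.Cell n), SubCAD.layeredSubCAD proj gen φ (n + 1) = some C →
      SubCAD.IsCAD n {c | c ∈ C} ∧
      (∀ c ∈ C, SubCAD.SignInvariant φ.polys c.carrier ∧ SubCAD.TruthInvariant φ c.carrier) ∧
      ∃ E : List (SubCAD.Cell n), SubCAD.layeredSubCAD proj gen φ ℓ = some E ∧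
        SubCAD.IsLayered ℓ {c | c ∈ C} {c | c ∈ E}) := by
  have hgen : SubCAD.GeneratesInvariantStacks n gen (SubCAD.projectionPolys proj n φ.polys) :=
    fun k hk c S hc hS => hcompat φ k hk c S hc hS
  set P := SubCAD.projectionPolys proj n φ.polys with hP
  have hCAD := SubCAD.isCAD_completedCAD hgen le_rfl
  refine ⟨?_, fun C hC => ?_⟩
  · rcases Option.eq_none_or_eq_some (SubCAD.layeredSubCAD proj gen φ ℓ) with h | ⟨E, hE⟩
    · exact .inl h
    refine .inr ⟨E, SubCAD.completedCAD gen P n, hE, hCAD, ?_,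
      fun c hc => (hCAD.regular_mem c hc).homeomorph,
      fun c hc => SubCAD.invariant_of_mem_layeredSubCAD hn hgen hE hc, fun c hc => ?_⟩
    · rw [SubCAD.isLayered_iff_indexDim hCAD.regular_mem]
      ext c
      exact SubCAD.mem_layeredSubCAD_iff hn hgen hE
    · obtain ⟨L, hL, -⟩ := SubCAD.layeredSubCAD_eq_some_iff.1 hE
      obtain ⟨i, rfl⟩ : ∃ i, n = i + 1 := ⟨n - 1, by omega⟩
      refine (SubCAD.reached_or_overDiscardedFailure hgen le_rfl hL hc).imp_left fun hr => ?_
      have hs := (hr.signInvariantBelow hgen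
        (fun p => SubCAD.ne_zero_of_mem_projectionPolys proj) le_rfl).signInvariant
      exact ⟨hs, hs.truthInvariant⟩
  · have hC' : {c | c ∈ C} = SubCAD.completedCAD gen P n := by
      ext c
      -- With `n + 1` layers the condition reads `n < dim + (n + 1)` and always holds.
      exact (SubCAD.mem_layeredSubCAD_iff hn hgen hC).trans (and_iff_left (by omega))
    rw [hC']
    refine ⟨hCAD, fun c hc => SubCAD.invariant_of_mem_layeredSubCAD hn hgen hC hc, ?_⟩
    obtain ⟨L', hL', -⟩ := SubCAD.layeredSubCAD_eq_some_iff.1 hC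
    obtain ⟨L, hL⟩ : ∃ L, SubCAD.lift gen P ℓ n = some L := by
      obtain ⟨i, rfl⟩ : ∃ i, n = i + 1 := ⟨n - 1, by omega⟩
      exact (SubCAD.exists_lift_of_le hℓn hL').imp fun _ h => h.1
    have hE := SubCAD.layeredSubCAD_eq_some_iff.2 ⟨L, hL, rfl⟩
    refine ⟨_, hE, ?_⟩
    rw [SubCAD.isLayered_iff_indexDim hCAD.regular_mem]
    ext c
    exact SubCAD.mem_layeredSubCAD_iff hn hgen hE
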